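/- **Conventions.** A semigroup presentation $\mathcal P=\langle\Sigma\mid\mathcal R\rangle$ consists of an alphabet $\Sigma$ and a set $\mathcal R$ of pairs $u=v$ of nonempty words over $\Sigma$, such that $u=v$ and $v=u$ never both belong to $\mathcal R$. Its Squier complex $S(\mathcal P)$ is the cube complex whose vertices are the nonempty words over $\Sigma$, whose edges $(a,u\to v,b)$, with $u=v$ in $\mathcal R$ and $a,b$ possibly empty words, join $aub$ to $avb$, and whose $n$-cubes are similarly the $(a_1,u_1\to v_1,\dots,a_n,u_n\to v_n,a_{n+1})$. For a nonempty word $w$, the diagram group $D(\mathcal P,w)$ is the (edge-path) fundamental group $\pi_1(S(\mathcal P),w)$. A group is a diagram group if it is isomorphic to some $D(\mathcal P,w)$. For a simplicial graph $\Gamma$, the right-angled Artin group is $A(\Gamma)=\langle v\in V(\Gamma)\mid [u,v]=1,\ (u,v)\in E(\Gamma)\rangle$, and $\overline\Gamma$ is the complement of $\Gamma$. The graph $\Gamma(\mathcal C)$ of a family $\mathcal C=(I_i)_{i\in\iota}$ of nonempty intervals (of a linearly ordered set) has vertex set $\iota$, with $i\neq j$ adjacent exactly when $I_i\cap I_j\neq\emptyset$.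 An interval graph is a graph of the form $\Gamma(\mathcal C)$ for a family $\mathcal C$ of nonempty intervals of $\mathbb R$. **Theorem.** 1. Let $n\ge 1$, and let $\mathcal C=(I_i)_{i\in\iota}$ be a finite family of nonempty intervals of $\{1,\dots,n\}$. For $I=\{k,k+1,\dots,l\}$ write $x_I=x_kx_{k+1}\cdots x_l$, and let $$\mathcal P(\mathcal C)=\langle x_1,\dots,x_n,\ a_i,b_i,c_i\ (i\in\iota)\mid x_{I_i}=a_i,\ a_i=b_i,\ b_i=c_i,\ c_i=a_i\ (i\in\iota)\rangle.$$ Then $D(\mathcal P(\mathcal C),x_1\cdots x_n)$ is isomorphic to the right-angled Artin group $A(\overline{\Gamma(\mathcal C)})$. 2. Let $\Gamma$ be a finite interval graph. Then $\Gamma=\Gamma(\mathcal C)$ for some $n\ge1$ and some family $\mathcal C$ of nonempty intervals of $\{1,\dots,n\}$ indexed by the vertices of $\Gamma$, and $A(\overline\Gamma)$ is a diagram group. -/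

import Mathlib

open CategoryTheory

universe u v

/-- A semigroup presentation `⟨σ ∣ R⟩`: a set of pairs of nonempty words over the alphabet `σ`,
where `u = v` and `v = u` are never both relations (in particular `u = u` is not one). -/
structure SemigroupPresentation (σ : Type u) where
  rels : Set (List σ × List σ)
  fst_ne_nil : ∀ r ∈ rels, r.1 ≠ []
  snd_ne_nil : ∀ r ∈ rels, r.2 ≠ []
  asymm : ∀ r ∈ rels, r.swap ∉ rels

namespace SemigroupPresentation

variable {σ : Type u}

/-- The vertices of the Squier complex `S(P)`: the nonempty words over the alphabet. -/
@[ext]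
structure SquierVertex (P : SemigroupPresentation σ) where
  word : List σ
  ne_nil : word ≠ []

/-- The edges `(a, p → q, b)` of the Squier complex, for `p = q` a relation and `a`, `b` possibly
empty words: such an edge goes from `apb` to `aqb`. The oppositely oriented edge `(a, q → p, b)` is
the formal inverse of this one in the free groupoid below. -/
@[ext]
structure SquierEdge (P : SemigroupPresentation σ) (w₁ w₂ : P.SquierVertex) where
  left : List σ
  src : List σ
  tgt : List σ
  right : List σ
  mem_rels : (src, tgt) ∈ P.rels
  src_eq : w₁.word = left ++ src ++ right
  tgt_eq : w₂.word = left ++ tgt ++ right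

instance (P : SemigroupPresentation σ) : Quiver P.SquierVertex where
  Hom := P.SquierEdge

/-- The homotopy class (up to backtracking) of the path that runs once along an edge of the
1-skeleton. -/
def edgeClass (P : SemigroupPresentation σ) {w₁ w₂ : P.SquierVertex} (e : P.SquierEdge w₁ w₂) :
    (Quiver.FreeGroupoid.of P.SquierVertex).obj w₁ ⟶
      (Quiver.FreeGroupoid.of P.SquierVertex).obj w₂ :=
  (Quiver.FreeGroupoid.of P.SquierVertex).map e

/-- Two-step paths in the 1-skeleton that run around the two halves of the boundary of a square
`(a, p → q, b, r → s, c)`. The corners of the square are the words `a m b m' c` with `m ∈ {p, q}`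
and `m' ∈ {r, s}`. -/
inductive SquareRel (P : SemigroupPresentation σ) :
    HomRel (Quiver.FreeGroupoid P.SquierVertex)
  | square (a p q b r s c : List σ) (w₀₀ w₁₀ w₀₁ w₁₁ : P.SquierVertex)
      (hpq : (p, q) ∈ P.rels) (hrs : (r, s) ∈ P.rels)
      (h₀₀ : w₀₀.word = a ++ p ++ b ++ r ++ c) (h₁₀ : w₁₀.word = a ++ q ++ b ++ r ++ c)
      (h₀₁ : w₀₁.word = a ++ p ++ b ++ s ++ c) (h₁₁ : w₁₁.word = a ++ q ++ b ++ s ++ c) :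
      SquareRel P
        (P.edgeClass (w₁ := w₀₀) (w₂ := w₁₀)
            ⟨a, p, q, b ++ r ++ c, hpq, by simp [h₀₀], by simp [h₁₀]⟩ ≫
          P.edgeClass (w₁ := w₁₀) (w₂ := w₁₁)
            ⟨a ++ q ++ b, r, s, c, hrs, by simp [h₁₀], by simp [h₁₁]⟩)
        (P.edgeClass (w₁ := w₀₀) (w₂ := w₀₁)
            ⟨a ++ p ++ b, r, s, c, hrs, by simp [h₀₀], by simp [h₀₁]⟩ ≫
          P.edgeClass (w₁ := w₀₁) (w₂ := w₁₁)
            ⟨a, p, q, b ++ s ++ c, hpq, by simp [h₀₁], by simp [h₁₁]⟩)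

/-- The (edge-path) fundamental groupoid of the Squier complex: edge paths in the 1-skeleton,
modulo backtracking and modulo the squares of the complex. (Cubes of dimension at least three
do not affect the fundamental groupoid.) -/
abbrev SquierGroupoid (P : SemigroupPresentation σ) : Type u :=
  CategoryTheory.Quotient P.SquareRel

/-- A vertex of the Squier complex, as an object of the fundamental groupoid. -/
def squierObj (P : SemigroupPresentation σ) (w : P.SquierVertex) : P.SquierGroupoid :=
  ⟨(Quiver.FreeGroupoid.of P.SquierVertex).obj w⟩

/-- The diagram group `D(P, w)`: the fundamental group of the Squier complex of `P`
based at the word `w`, with concatenation of loops as multiplication. -/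
def DiagramGroup (P : SemigroupPresentation σ) (w : P.SquierVertex) : Type u :=
  P.squierObj w ⟶ P.squierObj w

instance (P : SemigroupPresentation σ) (w : P.SquierVertex) : Group (P.DiagramGroup w) :=
  Groupoid.vertexGroup (P.squierObj w)

end SemigroupPresentation

/-- A group is a diagram group if it is isomorphic to `D(P, w)` for some semigroup presentation `P`
and some nonempty base word `w`. -/
def IsDiagramGroup (G : Type u) [Group G] : Prop :=
  ∃ (σ : Type u) (P : SemigroupPresentation σ) (w : P.SquierVertex),
    Nonempty (G ≃* P.DiagramGroup w)

/-- The right-angled Artin group `A(Γ) = ⟨v ∈ V(Γ) ∣ [u, v] = 1, (u, v) ∈ E(Γ)⟩`. -/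
abbrev RightAngledArtinGroup {V : Type u} (Γ : SimpleGraph V) : Type u :=
  PresentedGroup {r : FreeGroup V | ∃ x y : V, Γ.Adj x y ∧
    r = .of x * .of y * (FreeGroup.of x)⁻¹ * (FreeGroup.of y)⁻¹}

/-- The intersection graph of a family of sets: two distinct indices are adjacent when the
corresponding sets meet. -/
def intersectionGraph {ι : Type u} {α : Type v} (S : ι → Set α) : SimpleGraph ι where
  Adj i j := i ≠ j ∧ (S i ∩ S j).Nonempty
  symm := ⟨fun i j h => ⟨h.1.symm, by rw [Set.inter_comm]; exact h.2⟩⟩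
  loopless := ⟨fun _ h => h.1 rfl⟩

/-- A graph is an interval graph if it is the intersection graph of a family of (nonempty)
intervals of the real line. -/
def IsIntervalGraph {V : Type u} (Γ : SimpleGraph V) : Prop :=
  ∃ S : V → Set ℝ, (∀ x, (S x).OrdConnected ∧ (S x).Nonempty) ∧ Γ = intersectionGraph S

/-- The letters `x_k` (`k ∈ Fin n`) and `a_i`, `b_i`, `c_i` (`i ∈ ι`). -/
inductive IntervalLetter (n : ℕ) (ι : Type u) : Type u
  | x (k : Fin n)
  | a (i : ι)
  | b (i : ι)
  | c (i : ι)

/-- The word `x_I`: the product, in increasing order, of the letters `x_k` with `k ∈ I`. -/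
def intervalWord {n : ℕ} (ι : Type u) (I : NonemptyInterval (Fin n)) :
    List (IntervalLetter n ι) :=
  ((List.finRange n).filter fun k => I.fst ≤ k ∧ k ≤ I.snd).map .x

/-- The relations `x_I = a_I`, `a_I = b_I`, `b_I = c_I`, `c_I = a_I`, for `I` in the family. -/
inductive IntervalRelation {n : ℕ} {ι : Type u} (C : ι → NonemptyInterval (Fin n)) :
    List (IntervalLetter n ι) × List (IntervalLetter n ι) → Prop
  | xa (i : ι) : IntervalRelation C (intervalWord ι (C i), [.a i])
  | ab (i : ι) : IntervalRelation C ([.a i], [.b i])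
  | bc (i : ι) : IntervalRelation C ([.b i], [.c i])
  | ca (i : ι) : IntervalRelation C ([.c i], [.a i])

theorem fst_mem_intervalWord {n : ℕ} (ι : Type u) (I : NonemptyInterval (Fin n)) :
    IntervalLetter.x I.fst ∈ intervalWord ι I := by
  simp [intervalWord, I.fst_le_snd]

/-- The semigroup presentation `P(C)` of a family `C` of intervals of `Fin n`. -/
def intervalPresentation {n : ℕ} {ι : Type u} (C : ι → NonemptyInterval (Fin n)) :
    SemigroupPresentation (IntervalLetter n ι) where
  rels := {r | IntervalRelation C r}
  fst_ne_nil := by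
    rintro _ (i | i | i | i) h
    · simpa [show intervalWord ι (C i) = [] from h] using fst_mem_intervalWord ι (C i)
    all_goals simp at h
  snd_ne_nil := by
    rintro _ (i | i | i | i) h <;> simp at h
  asymm := by
    intro r h h'
    have key : ∀ (i : ι) (l : IntervalLetter n ι), (∀ k, l ≠ .x k) → intervalWord ι (C i) ≠ [l] := by
      intro i l hl e
      have := fst_mem_intervalWord ι (C i)
      rw [e, List.mem_singleton] at this
      exact hl _ this.symm
    rcases r with ⟨r₁, r₂⟩
    change IntervalRelation C (r₁, r₂) at h
    change IntervalRelation C (r₂, r₁) at h'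
    generalize hs : (r₁, r₂) = s at h
    generalize hs' : (r₂, r₁) = s' at h'
    cases h <;> cases h' <;> simp only [Prod.mk.injEq] at hs hs' <;>
      obtain ⟨h₁, h₂⟩ := hs <;> obtain ⟨h₃, h₄⟩ := hs' <;> subst h₁ h₂ <;>
      first
        | exact key _ _ (by simp) h₃.symm
        | exact key _ _ (by simp) h₄
        | simp at h₃ h₄

/-- The base word `x_1 ⋯ x_n` (`n ≥ 1`). -/
def intervalBaseWord {n : ℕ} (hn : 0 < n) {ι : Type u} (C : ι → NonemptyInterval (Fin n)) :
    (intervalPresentation C).SquierVertex where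
  word := (List.finRange n).map .x
  ne_nil := by simpa using hn.ne'

/-!
The words that can be reached from `x_1 ⋯ x_n` are those obtained from it by replacing the subwords
`x_I`, for `I` in a subfamily of pairwise disjoint intervals, by one of the letters `a_I`, `b_I`,
`c_I`. They are recognised by their expansion: replacing every letter `a_I`, `b_I`, `c_I` by `x_I`
has to give `x_1 ⋯ x_n` (`Covers`). So the component of the base word is a union of products, over
the families of pairwise disjoint intervals, of lollipops: an edge `x_I → a_I` with the triangle
`a_I → b_I → c_I → a_I` at its end. Each lollipop contributes one generator to the fundamental
group, and the squares make the generators of disjoint intervals commute.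

The proof gives mutually inverse homomorphisms. In one direction, `loopHom` sends a generator to the
loop around its triangle; loops of disjoint intervals commute since two diagrams with disjoint
supports do (`Diagram.eval_comm`). In the other direction, `labelHom` multiplies the labels of the
edges along a loop, where the edges `c_I → a_I` are labelled by the generator of `I` and the other
edges by `1`; two such labels on a square at a covering word commute since the two intervals are
disjoint. The composite `labelHom ∘ loopHom` is the identity on generators.

It remains to see that `loopHom` is surjective. Every covering word has a path to the base word, its
`collapse`, which follows the edges of the lollipops other than `c_I → a_I` back to `x_I`, letter by
letter. An edge between two covering words is, relative to these paths, trivial or a loop around a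
triangle (`edgeArrow_comp_collapseArrow`), since the collapses of the letters away from the edge can
be slid past it. As every loop is a composite of edges and their inverses, it is in the image.

For the second part, a finite family of real intervals is intersected with a finite set of points
that meets all nonempty pairwise intersections; on this finite linear order the intervals are
discrete.
-/

/-! ### Diagrams and their edge paths -/

namespace SemigroupPresentation

variable {σ : Type u} {P : SemigroupPresentation σ}

/-- The arrow of the fundamental groupoid given by an edge of the Squier complex. -/
def edgeArrow (P : SemigroupPresentation σ) {w₁ w₂ : P.SquierVertex} (e : P.SquierEdge w₁ w₂) :
    P.squierObj w₁ ⟶ P.squierObj w₂ :=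
  (Quotient.functor P.SquareRel).map (P.edgeClass e)

/-- Every arrow of the fundamental groupoid is a composite of edges and inverses of edges. -/
theorem squier_induction
    {motive : ∀ W W' : P.SquierVertex, (P.squierObj W ⟶ P.squierObj W') → Prop}
    (id : ∀ W, motive W W (𝟙 _))
    (comp_edge : ∀ W W' W'' f (e : P.SquierEdge W' W''), motive W W' f →
      motive W W'' (f ≫ P.edgeArrow e))
    (comp_inv_edge : ∀ W W' W'' f (e : P.SquierEdge W'' W'), motive W W' f →
      motive W W'' (f ≫ inv (P.edgeArrow e)))
    (W W' : P.SquierVertex) (f : P.squierObj W ⟶ P.squierObj W') : motive W W' f := by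
  suffices key : ∀ p : Quiver.Path (V := Quiver.Symmetrify P.SquierVertex) W W',
      motive W W' (Quot.mk _ (Quot.mk _ p)) by
    obtain ⟨g⟩ := f
    obtain ⟨p⟩ := g
    exact key p
  clear f
  intro p
  induction p with
  | nil => exact id W
  | @cons W₁ W₂ p e ih =>
    rcases e with e | e
    · exact comp_edge _ _ _ _ e ih
    · have := comp_inv_edge _ _ _ _ e ih
      rw [← Groupoid.inv_eq_inv] at this
      exact this

/-- Semigroup diagrams over `P`, as formal expressions: cells, their mirror images, and vertical
(`trans`) and horizontal (`append`) composites. A diagram stands for an edge path in the Squier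
complex, in every context `a _ b` simultaneously. -/
inductive Diagram (P : SemigroupPresentation σ) : List σ → List σ → Type u
  | refl (u : List σ) : Diagram P u u
  | cell {u v : List σ} (h : (u, v) ∈ P.rels) : Diagram P u v
  | symm {u v : List σ} (d : Diagram P u v) : Diagram P v u
  | trans {u v w : List σ} (d : Diagram P u v) (e : Diagram P v w) : Diagram P u w
  | append {u u' v v' : List σ} (d : Diagram P u u') (e : Diagram P v v') :
      Diagram P (u ++ v) (u' ++ v')

namespace Diagram

theorem eq_nil_iff {u v : List σ} (d : P.Diagram u v) : u = [] ↔ v = [] := by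
  induction d with
  | refl => rfl
  | cell h => simp [P.fst_ne_nil _ h, P.snd_ne_nil _ h]
  | symm d ih => exact ih.symm
  | trans d e ihd ihe => exact ihd.trans ihe
  | append d e ihd ihe => simp [ihd, ihe]

theorem context_ne_nil {u v : List σ} (d : P.Diagram u v) {a b : List σ} {W : P.SquierVertex}
    (h : W.word = a ++ u ++ b) : a ++ v ++ b ≠ [] := by
  have := W.ne_nil
  rw [h] at this
  simpa [d.eq_nil_iff] using this

/-- The arrow of the fundamental groupoid traced out by a diagram `u → v` in the context `a _ b`.
The end points `W` and `W'` are arbitrary vertices with underlying words `aub` and `avb`, so that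
no transport along associativity of concatenation is needed. -/
noncomputable def eval : ∀ {u v : List σ}, P.Diagram u v → ∀ (a b : List σ) (W W' : P.SquierVertex),
    W.word = a ++ u ++ b → W'.word = a ++ v ++ b → (P.squierObj W ⟶ P.squierObj W')
  | _, _, refl _, _, _, _, _, h, h' =>
      eqToHom (congrArg P.squierObj (SquierVertex.ext (h.trans h'.symm)))
  | _, _, cell hr, a, b, _, _, h, h' => P.edgeArrow ⟨a, _, _, b, hr, h, h'⟩
  | _, _, symm d, a, b, W, W', h, h' => inv (d.eval a b W' W h' h)
  | _, _, trans (v := v) d e, a, b, W, W', h, h' =>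
      d.eval a b W ⟨a ++ v ++ b, d.context_ne_nil h⟩ h rfl ≫ e.eval a b _ W' rfl h'
  | _, _, append (u' := u') (v := v) d e, a, b, W, W', h, h' =>
      d.eval a (v ++ b) W
          ⟨a ++ u' ++ (v ++ b), d.context_ne_nil (W := W) (by simp [h])⟩ (by simp [h]) rfl ≫
        e.eval (a ++ u') b _ W' (by simp) (by simp [h'])

theorem eval_refl (u a b : List σ) (W : P.SquierVertex) (h h') :
    (refl (P := P) u).eval a b W W h h' = 𝟙 _ := by
  simp [eval]

theorem eval_congr {u v : List σ} (d : P.Diagram u v) {a a' b b' : List σ} (ha : a = a')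
    (hb : b = b') (W W' : P.SquierVertex) (h h') :
    d.eval a b W W' h h' = d.eval a' b' W W' (by simp [h, ha, hb]) (by simp [h', ha, hb]) := by
  subst ha hb
  rfl

theorem eval_symm {u v : List σ} (d : P.Diagram u v) (a b : List σ) (W W' : P.SquierVertex)
    (h h') : d.symm.eval a b W W' h h' = inv (d.eval a b W' W h' h) := by
  simp [eval]

theorem eval_trans {u v w : List σ} (d : P.Diagram u v) (e : P.Diagram v w) (a b : List σ)
    (W M W' : P.SquierVertex) (h h') (hM : M.word = a ++ v ++ b) :
    (d.trans e).eval a b W W' h h' = d.eval a b W M h hM ≫ e.eval a b M W' hM h' := by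
  obtain ⟨m, hm⟩ := M
  obtain rfl : m = _ := hM
  simp [eval]

theorem eval_append {u u' v v' : List σ} (d : P.Diagram u u') (e : P.Diagram v v') (a b : List σ)
    (W M W' : P.SquierVertex) (h h') (hM : M.word = a ++ u' ++ (v ++ b)) :
    (d.append e).eval a b W W' h h' =
      d.eval a (v ++ b) W M (by simp [h]) hM ≫
        e.eval (a ++ u') b M W' (by simp [hM]) (by simp [h']) := by
  obtain ⟨m, hm⟩ := M
  obtain rfl : m = _ := hM
  simp [eval]

/-- Two edges with disjoint supports commute: this is the defining relation of a square. -/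
theorem eval_cell_comm_cell {u u' v v' : List σ} (f : (u, u') ∈ P.rels) (g : (v, v') ∈ P.rels)
    (a b c x y s t : List σ) (W₀₀ W₁₀ W₀₁ W₁₁ : P.SquierVertex)
    (hx : x = b ++ v ++ c) (hy : y = b ++ v' ++ c) (hs : s = a ++ u ++ b) (ht : t = a ++ u' ++ b)
    (f₀ f₀' f₁ f₁' g₀ g₀' g₁ g₁') :
    (cell f).eval a x W₀₀ W₁₀ f₀ f₀' ≫ (cell g).eval t c W₁₀ W₁₁ g₁ g₁' =
      (cell g).eval s c W₀₀ W₀₁ g₀ g₀' ≫ (cell f).eval a y W₀₁ W₁₁ f₁ f₁' := by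
  subst hx hy hs ht
  have := CategoryTheory.Quotient.sound _ (
    SquareRel.square (P := P) a u u' b v v' c W₀₀ W₁₀ W₀₁ W₁₁ f g
    (by simp [f₀]) (by simp [f₀']) (by simp [f₁]) (by simp [f₁']))
  rw [Functor.map_comp, Functor.map_comp] at this
  simpa only [eval] using! this

theorem eval_cell_comm {u u' v v' : List σ} (f : (u, u') ∈ P.rels) (g : P.Diagram v v')
    (a b c x y s t : List σ) (W₀₀ W₁₀ W₀₁ W₁₁ : P.SquierVertex)
    (hx : x = b ++ v ++ c) (hy : y = b ++ v' ++ c) (hs : s = a ++ u ++ b) (ht : t = a ++ u' ++ b)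
    (f₀ f₀' f₁ f₁' g₀ g₀' g₁ g₁') :
    (cell f).eval a x W₀₀ W₁₀ f₀ f₀' ≫ g.eval t c W₁₀ W₁₁ g₁ g₁' =
      g.eval s c W₀₀ W₀₁ g₀ g₀' ≫ (cell f).eval a y W₀₁ W₁₁ f₁ f₁' := by
  induction g generalizing b c x y s t W₀₀ W₁₀ W₀₁ W₁₁ with
  | refl v =>
    obtain rfl : W₀₀ = W₀₁ := SquierVertex.ext (g₀.trans g₀'.symm)
    obtain rfl : W₁₀ = W₁₁ := SquierVertex.ext (g₁.trans g₁'.symm)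
    obtain rfl : x = y := hx.trans hy.symm
    simp [eval_refl]
  | cell g => exact eval_cell_comm_cell f g a b c x y s t _ _ _ _ hx hy hs ht _ _ _ _ _ _ _ _
  | symm d ih =>
    have := ih b c y x s t W₀₁ W₁₁ W₀₀ W₁₀ hy hx hs ht f₁ f₁' f₀ f₀' g₀' g₀ g₁' g₁
    rw [eval_symm, eval_symm, IsIso.comp_inv_eq, Category.assoc, this, IsIso.inv_hom_id_assoc]
  | @trans v w v' d e ihd ihe =>
    subst hx hy hs ht
    let M₀ : P.SquierVertex := ⟨a ++ u ++ b ++ w ++ c, d.context_ne_nil g₀⟩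
    let M₁ : P.SquierVertex := ⟨a ++ u' ++ b ++ w ++ c, d.context_ne_nil g₁⟩
    rw [eval_trans d e _ _ _ M₁ _ _ _ rfl, eval_trans d e _ _ _ M₀ _ _ _ rfl, ← Category.assoc,
      ihd b c _ (b ++ w ++ c) _ _ W₀₀ W₁₀ M₀ M₁ rfl rfl rfl rfl _ _ (by simp [M₀]) (by simp [M₁])
        g₀ rfl g₁ rfl,
      Category.assoc,
      ihe b c _ _ _ _ M₀ M₁ W₀₁ W₁₁ rfl rfl rfl rfl _ _ f₁ f₁' rfl g₀' rfl g₁', Category.assoc]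
  | @append v w v' w' d e ihd ihe =>
    subst hx hy hs ht
    let M₀ : P.SquierVertex :=
      ⟨a ++ u ++ b ++ w ++ (v' ++ c), d.context_ne_nil (W := W₀₀) (by simp [g₀])⟩
    let M₁ : P.SquierVertex :=
      ⟨a ++ u' ++ b ++ w ++ (v' ++ c), d.context_ne_nil (W := W₁₀) (by simp [g₁])⟩
    rw [eval_append d e _ _ _ M₁ _ _ _ rfl, eval_append d e _ _ _ M₀ _ _ _ rfl, ← Category.assoc,
      ihd b (v' ++ c) _ (b ++ w ++ (v' ++ c)) _ _ W₀₀ W₁₀ M₀ M₁ (by simp) rfl rfl rfl _ _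
        (by simp [M₀]) (by simp [M₁]) (by simp [g₀]) rfl (by simp [g₁]) rfl,
      Category.assoc,
      ihe (b ++ w) c _ _ (a ++ u ++ b ++ w) (a ++ u' ++ b ++ w) M₀ M₁ W₀₁ W₁₁
        (by simp) (by simp) (by simp) (by simp) _ _ f₁ f₁'
        (by simp [M₀]) (by simp [g₀']) (by simp [M₁]) (by simp [g₁']), Category.assoc]

/-- Diagrams with disjoint supports commute. The contexts `x`, `y`, `s`, `t` are those forced by
a word of the form `a _ b _ c`. -/
theorem eval_comm {u u' v v' : List σ} (f : P.Diagram u u') (g : P.Diagram v v')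
    (a b c x y s t : List σ) (W₀₀ W₁₀ W₀₁ W₁₁ : P.SquierVertex)
    (hx : x = b ++ v ++ c) (hy : y = b ++ v' ++ c) (hs : s = a ++ u ++ b) (ht : t = a ++ u' ++ b)
    (f₀ f₀' f₁ f₁' g₀ g₀' g₁ g₁') :
    f.eval a x W₀₀ W₁₀ f₀ f₀' ≫ g.eval t c W₁₀ W₁₁ g₁ g₁' =
      g.eval s c W₀₀ W₀₁ g₀ g₀' ≫ f.eval a y W₀₁ W₁₁ f₁ f₁' := by
  induction f generalizing a b c x y s t W₀₀ W₁₀ W₀₁ W₁₁ with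
  | refl u =>
    obtain rfl : W₀₀ = W₁₀ := SquierVertex.ext (f₀.trans f₀'.symm)
    obtain rfl : W₀₁ = W₁₁ := SquierVertex.ext (f₁.trans f₁'.symm)
    obtain rfl : s = t := hs.trans ht.symm
    simp [eval_refl]
  | cell f => exact eval_cell_comm f g a b c x y s t _ _ _ _ hx hy hs ht _ _ _ _ _ _ _ _
  | symm d ih =>
    have := ih a b c x y t s W₁₀ W₀₀ W₁₁ W₀₁ hx hy ht hs f₀' f₀ f₁' f₁ g₁ g₁' g₀ g₀'
    rw [eval_symm, eval_symm, IsIso.inv_comp_eq, ← Category.assoc, this, Category.assoc,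
      IsIso.hom_inv_id, Category.comp_id]
  | @trans u w u' d e ihd ihe =>
    subst hx hy hs ht
    let M₀ : P.SquierVertex := ⟨a ++ w ++ (b ++ v ++ c), d.context_ne_nil f₀⟩
    let M₁ : P.SquierVertex := ⟨a ++ w ++ (b ++ v' ++ c), d.context_ne_nil f₁⟩
    rw [eval_trans d e _ _ _ M₁ _ _ _ rfl, eval_trans d e _ _ _ M₀ _ _ _ rfl, Category.assoc,
      ihe a b c _ _ (a ++ w ++ b) _ M₀ W₁₀ M₁ W₁₁ rfl rfl rfl rfl rfl f₀' rfl f₁'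
        (by simp [M₀]) (by simp [M₁]) g₁ g₁',
      ← Category.assoc,
      ihd a b c _ _ _ _ W₀₀ M₀ W₀₁ M₁ rfl rfl rfl rfl f₀ rfl f₁ rfl g₀ g₀', Category.assoc]
  | @append u w u' w' d e ihd ihe =>
    subst hx hy hs ht
    let M₀ : P.SquierVertex :=
      ⟨a ++ w ++ (u' ++ (b ++ v ++ c)), d.context_ne_nil (W := W₀₀) (by simp [f₀])⟩
    let M₁ : P.SquierVertex :=
      ⟨a ++ w ++ (u' ++ (b ++ v' ++ c)), d.context_ne_nil (W := W₀₁) (by simp [f₁])⟩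
    rw [eval_append d e _ _ _ M₁ _ _ _ rfl, eval_append d e _ _ _ M₀ _ _ _ rfl, Category.assoc,
      ihe (a ++ w) b c _ _ (a ++ w ++ u' ++ b) _ M₀ W₁₀ M₁ W₁₁ rfl rfl rfl (by simp)
        (by simp [M₀]) (by simp [f₀']) (by simp [M₁]) (by simp [f₁'])
        (by simp [M₀]) (by simp [M₁]) g₁ g₁',
      ← Category.assoc,
      ihd a (u' ++ b) c _ _ _ _ W₀₀ M₀ W₀₁ M₁ (by simp) (by simp) (by simp) (by simp)
        (by simp [f₀]) rfl (by simp [f₁]) rfl g₀ g₀', Category.assoc]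

end Diagram

end SemigroupPresentation

/-! ### Subwords of the base word -/

theorem List.Pairwise.eq_filter_append_filter_append_filter {α : Type*} [LinearOrder α]
    {L : List α} (hL : L.Pairwise (· < ·)) {m M : α} (hm : m ≤ M) :
    L = L.filter (fun k => k < m) ++ L.filter (fun k => m ≤ k ∧ k ≤ M) ++
      L.filter (fun k => M < k) := by
  induction L with
  | nil => simp
  | cons x L ih =>
    obtain ⟨hx, hL⟩ := List.pairwise_cons.1 hL
    have ih := ih hL
    rcases lt_or_ge x m with h | h
    · have h₁ : ¬ m ≤ x := h.not_ge
      have h₂ : ¬ M < x := (h.trans_le hm).not_gt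
      simpa [List.filter_cons, h, h₁, h₂] using ih
    · have h₀ : ¬ x < m := h.not_gt
      have e₁ : L.filter (fun k => k < m) = [] := by
        simpa using fun k hk => h.trans (hx k hk).le
      rcases le_or_gt x M with h' | h'
      · simpa [List.filter_cons, h, h₀, h', h'.not_gt, e₁] using ih
      · have e₂ : L.filter (fun k => m ≤ k ∧ k ≤ M) = [] := by
          simpa using fun k hk _ => h'.trans (hx k hk)
        rw [List.filter_cons_of_neg (by simpa using h), List.filter_cons_of_neg
          (by simpa using fun _ => h'), List.filter_cons_of_pos (by simpa using h'), e₁, e₂]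
        rw [e₁, e₂] at ih
        exact congrArg (x :: ·) ih

section Words

variable {n : ℕ} {ι : Type u}

theorem nodup_map_x : ((List.finRange n).map (IntervalLetter.x (ι := ι))).Nodup :=
  (List.nodup_finRange n).map fun _ _ h => by simpa using h

theorem mem_intervalWord {I : NonemptyInterval (Fin n)} {k : Fin n} :
    IntervalLetter.x k ∈ intervalWord ι I ↔ k ∈ I := by
  simp [intervalWord, NonemptyInterval.mem_def]

theorem intervalWord_ne_nil (I : NonemptyInterval (Fin n)) : intervalWord ι I ≠ [] :=
  List.ne_nil_of_mem (fst_mem_intervalWord ι I)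

variable (ι) in
/-- The part of the base word to the left of the interval `I`. -/
def leftWord (I : NonemptyInterval (Fin n)) : List (IntervalLetter n ι) :=
  ((List.finRange n).filter fun k => k < I.fst).map .x

variable (ι) in
/-- The part of the base word to the right of the interval `I`. -/
def rightWord (I : NonemptyInterval (Fin n)) : List (IntervalLetter n ι) :=
  ((List.finRange n).filter fun k => I.snd < k).map .x

theorem map_x_eq (I : NonemptyInterval (Fin n)) :
    (List.finRange n).map .x = leftWord ι I ++ intervalWord ι I ++ rightWord ι I := by
  rw [leftWord, intervalWord, rightWord, ← List.map_append, ← List.map_append,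
    ← (List.pairwise_lt_finRange n).eq_filter_append_filter_append_filter I.fst_le_snd]

theorem eq_leftWord_and_eq_rightWord {I : NonemptyInterval (Fin n)}
    {a b : List (IntervalLetter n ι)}
    (h : a ++ intervalWord ι I ++ b = (List.finRange n).map .x) :
    a = leftWord ι I ∧ b = rightWord ι I := by
  have hn := nodup_map_x (n := n) (ι := ι)
  rw [← h] at hn
  rw [map_x_eq I] at h
  obtain ⟨y, L, hL⟩ := List.exists_cons_of_ne_nil (intervalWord_ne_nil (ι := ι) I)
  simp only [hL, List.append_assoc, List.cons_append] at h hn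
  obtain ⟨-, hb, -⟩ := List.nodup_append.1 hn
  obtain ⟨h₁, -, h₂⟩ := (List.append_cons_inj_of_notMem
    (fun hy => List.disjoint_of_nodup_append hn hy List.mem_cons_self)
    (List.nodup_cons.1 hb).1).1 h
  exact ⟨h₁, List.append_cancel_left h₂⟩

theorem exists_map_x_eq {I J : NonemptyInterval (Fin n)} (h : I.snd < J.fst) :
    ∃ b c, (List.finRange n).map .x =
      leftWord ι I ++ intervalWord ι I ++ b ++ intervalWord ι J ++ c := by
  have hs := ((List.pairwise_lt_finRange n).filter
    (fun k => I.snd < k)).eq_filter_append_filter_append_filter J.fst_le_snd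
  have hJ : ((List.finRange n).filter (fun k => I.snd < k)).filter
      (fun k => J.fst ≤ k ∧ k ≤ J.snd) =
      (List.finRange n).filter (fun k => J.fst ≤ k ∧ k ≤ J.snd) := by
    rw [List.filter_filter]
    refine List.filter_congr fun k _ => ?_
    have : J.fst ≤ k → I.snd < k := h.trans_le
    simpa using fun h₁ _ => this h₁
  rw [hJ] at hs
  rw [map_x_eq I, rightWord, hs, List.map_append, List.map_append, ← List.append_assoc,
    ← List.append_assoc]
  exact ⟨_, _, rfl⟩

end Words

/-! ### The label homomorphism -/

theorem Quiver.FreeGroupoid.lift_map_of {V : Type*} [Quiver V] {G : Type*} [Groupoid G]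
    (φ : V ⥤q G) {x y : V} (e : x ⟶ y) :
    (Quiver.FreeGroupoid.lift φ).map ((Quiver.FreeGroupoid.of V).map e) = φ.map e :=
  Category.id_comp (φ.map e)

open SemigroupPresentation MulOpposite

section Label

variable {n : ℕ} {ι : Type u} (C : ι → NonemptyInterval (Fin n))

/-- The right-angled Artin group on the complement of the intersection graph of `C`. -/
abbrev IntervalArtinGroup : Type u :=
  RightAngledArtinGroup (intersectionGraph fun i => (C i : Set (Fin n)))ᶜ

variable {C} in
theorem commute_of_of_disjoint {i j : ι} (h : ∀ k, k ∈ C i → k ∉ C j) :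
    Commute (PresentedGroup.of i : IntervalArtinGroup C) (PresentedGroup.of j) := by
  have hij : i ≠ j := by
    rintro rfl
    exact h (C i).fst ⟨le_rfl, (C i).fst_le_snd⟩ ⟨le_rfl, (C i).fst_le_snd⟩
  have hadj : (intersectionGraph fun i => (C i : Set (Fin n)))ᶜ.Adj i j := by
    rw [SimpleGraph.compl_adj]
    refine ⟨hij, fun ⟨_, k, hk, hk'⟩ => h k hk hk'⟩
  have := PresentedGroup.one_of_mem (rels := {r : FreeGroup ι | ∃ x y : ι,
    (intersectionGraph fun i => (C i : Set (Fin n)))ᶜ.Adj x y ∧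
    r = .of x * .of y * (FreeGroup.of x)⁻¹ * (FreeGroup.of y)⁻¹}) ⟨i, j, hadj, rfl⟩
  simp only [map_mul, map_inv] at this
  rwa [mul_inv_eq_one, mul_inv_eq_iff_eq_mul] at this

/-- The word in the letters `x_k` covered by a letter of `P(C)`. -/
def IntervalLetter.expand : IntervalLetter n ι → List (IntervalLetter n ι)
  | .x k => [.x k]
  | .a i | .b i | .c i => intervalWord ι (C i)

/-- The word in the letters `x_k` covered by a word of `P(C)`. -/
def expandWord (w : List (IntervalLetter n ι)) : List (IntervalLetter n ι) :=
  w.flatMap (IntervalLetter.expand C)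

@[simp]
theorem expandWord_append (w w' : List (IntervalLetter n ι)) :
    expandWord C (w ++ w') = expandWord C w ++ expandWord C w' := by
  simp [expandWord]

theorem expandWord_map_x (L : List (Fin n)) :
    expandWord C (L.map .x) = L.map .x := by
  induction L with
  | nil => rfl
  | cons k L ih => simpa [expandWord, IntervalLetter.expand] using ih

@[simp]
theorem expandWord_intervalWord (I : NonemptyInterval (Fin n)) :
    expandWord C (intervalWord ι I) = intervalWord ι I :=
  expandWord_map_x C _

theorem expandWord_eq_of_mem_rels {u v : List (IntervalLetter n ι)}
    (h : (u, v) ∈ (intervalPresentation C).rels) : expandWord C u = expandWord C v := by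
  change IntervalRelation C (u, v) at h
  cases h
  · rw [expandWord_intervalWord]; simp [expandWord, IntervalLetter.expand]
  all_goals rfl

/-- A word *covers* the base word if its expansion is `x_1 ⋯ x_n`. These are the words in the
connected component of the base word. -/
def Covers (w : List (IntervalLetter n ι)) : Prop :=
  expandWord C w = (List.finRange n).map .x

variable {C}

theorem covers_congr {a u v b : List (IntervalLetter n ι)}
    (h : (u, v) ∈ (intervalPresentation C).rels) :
    Covers C (a ++ u ++ b) ↔ Covers C (a ++ v ++ b) := by
  simp [Covers, expandWord_eq_of_mem_rels C h]

theorem covers_iff_of_edge {W W' : (intervalPresentation C).SquierVertex}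
    (e : (intervalPresentation C).SquierEdge W W') : Covers C W.word ↔ Covers C W'.word := by
  rw [e.src_eq, e.tgt_eq, covers_congr e.mem_rels]

theorem disjoint_of_covers {a b c : List (IntervalLetter n ι)} {i j : ι}
    (h : Covers C (a ++ [.c i] ++ b ++ [.c j] ++ c)) (k : Fin n) (hi : k ∈ C i) : k ∉ C j := by
  intro hj
  have hn := nodup_map_x (n := n) (ι := ι)
  rw [← h] at hn
  have e : ∀ i, expandWord C [.c i] = intervalWord ι (C i) := fun i => by
    simp [expandWord, IntervalLetter.expand]
  simp only [expandWord_append, e, List.append_assoc] at hn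
  have := (List.nodup_append.1 (List.nodup_append.1 hn).2.1).2.2 _ (mem_intervalWord.2 hi) (.x k)
  simp [mem_intervalWord.2 hj] at this

variable (C)

/-- The label of an edge with source `u`: the generator of `i` if the edge is `c_i → a_i`, and
trivial otherwise. -/
def edgeLabel : List (IntervalLetter n ι) → IntervalArtinGroup C
  | [.c i] => .of i
  | _ => 1

theorem edgeLabel_intervalWord (I : NonemptyInterval (Fin n)) :
    edgeLabel C (intervalWord ι I) = 1 := by
  unfold intervalWord
  generalize (List.finRange n).filter _ = L
  rcases L with _ | ⟨k, _ | ⟨k', L⟩⟩ <;> rfl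

theorem edgeLabel_comm (u v : List (IntervalLetter n ι)) {a b c : List (IntervalLetter n ι)}
    (h : Covers C (a ++ u ++ b ++ v ++ c)) : Commute (edgeLabel C u) (edgeLabel C v) := by
  unfold edgeLabel
  split
  · split
    · exact commute_of_of_disjoint (disjoint_of_covers h)
    · exact Commute.one_right _
  · exact Commute.one_left _

open Classical in
/-- The functor recording the labels of the edges along a path through covering words. Edges outside
the component of the base word have trivial label: there the labels need not be compatible with the
squares. The opposite group appears since composition in `SingleObj` is reversed multiplication. -/
noncomputable def labelFunctor :
    (intervalPresentation C).SquierGroupoid ⥤ SingleObj (IntervalArtinGroup C)ᵐᵒᵖ :=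
  CategoryTheory.Quotient.lift _
    (Quiver.FreeGroupoid.lift
      { obj := fun _ => SingleObj.star _
        map := fun {W _} e => if Covers C W.word then op (edgeLabel C e.src) else 1 }) <| by
    rintro _ _ _ _ ⟨a, p, q, b, r, s, c, w₀₀, w₁₀, w₀₁, w₁₁, hpq, hrs, h₀₀, h₁₀, h₀₁, h₁₁⟩
    simp only [Functor.map_comp, edgeClass, Quiver.FreeGroupoid.lift_map_of]
    have e₁ : Covers C w₀₀.word ↔ Covers C w₁₀.word := by
      rw [h₀₀, h₁₀]; simpa using covers_congr (a := a) (b := b ++ r ++ c) hpq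
    have e₂ : Covers C w₀₀.word ↔ Covers C w₀₁.word := by
      rw [h₀₀, h₀₁]; simpa using covers_congr (a := a ++ p ++ b) (b := c) hrs
    simp only [← e₁, ← e₂, SingleObj.comp_as_mul]
    split_ifs with h
    · rw [h₀₀] at h
      rw [← op_mul, ← op_mul, (edgeLabel_comm C p r h).eq]
    · rfl

theorem labelFunctor_map_edgeArrow {W W' : (intervalPresentation C).SquierVertex}
    (h : Covers C W.word) (e : (intervalPresentation C).SquierEdge W W') :
    (labelFunctor C).map (edgeArrow _ e) = op (edgeLabel C e.src) := by
  refine (Quiver.FreeGroupoid.lift_map_of _ _).trans ?_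
  exact if_pos h

/-- The homomorphism from the diagram group to the right-angled Artin group that multiplies the
labels along a loop. -/
noncomputable def labelHom (W : (intervalPresentation C).SquierVertex) :
    (intervalPresentation C).DiagramGroup W →* IntervalArtinGroup C where
  toFun f := unop ((labelFunctor C).map f)
  map_one' := congrArg unop ((labelFunctor C).map_id _)
  map_mul' f g := congrArg unop ((labelFunctor C).map_comp f g)

end Label

/-! ### Collapsing covering words to the base word -/

section Collapse

variable {n : ℕ} {ι : Type u} (C : ι → NonemptyInterval (Fin n))

/-- The edge `x_I → a_I` as a diagram. -/
def cellXA (i : ι) : (intervalPresentation C).Diagram (intervalWord ι (C i)) [.a i] :=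
  .cell (.xa i)

/-- The edge `a_I → b_I` as a diagram. -/
def cellAB (i : ι) : (intervalPresentation C).Diagram [.a i] [.b i] := .cell (.ab i)

/-- The edge `b_I → c_I` as a diagram. -/
def cellBC (i : ι) : (intervalPresentation C).Diagram [.b i] [.c i] := .cell (.bc i)

/-- The edge `c_I → a_I` as a diagram. -/
def cellCA (i : ι) : (intervalPresentation C).Diagram [.c i] [.a i] := .cell (.ca i)

/-- The spherical diagram that goes from `x_I` to `a_I`, once around the triangle
`a_I → b_I → c_I → a_I`, and back to `x_I`. -/
def loopDiagram (i : ι) :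
    (intervalPresentation C).Diagram (intervalWord ι (C i)) (intervalWord ι (C i)) :=
  (cellXA C i).trans ((cellAB C i).trans ((cellBC C i).trans
    ((cellCA C i).trans (cellXA C i).symm)))

/-- The diagram from a letter to its expansion that avoids the edge `c_I → a_I`. -/
def collapseLetter :
    ∀ l : IntervalLetter n ι, (intervalPresentation C).Diagram [l] (l.expand C)
  | .x k => .refl [IntervalLetter.x k]
  | .a i => (cellXA C i).symm
  | .b i => (cellAB C i).symm.trans (cellXA C i).symm
  | .c i => (cellBC C i).symm.trans ((cellAB C i).symm.trans (cellXA C i).symm)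

/-- The diagram from a word to its expansion that collapses the letters from left to right. -/
def collapse : ∀ w : List (IntervalLetter n ι), (intervalPresentation C).Diagram w (expandWord C w)
  | [] => .refl []
  | l :: w => (collapseLetter C l).append (collapse w)

variable {C}

theorem collapse_nil_eval (a b : List (IntervalLetter n ι))
    (W : (intervalPresentation C).SquierVertex) (h h') :
    (collapse C []).eval a b W W h h' = 𝟙 _ :=
  Diagram.eval_refl [] a b W h h'

theorem collapse_cons_eval (l : IntervalLetter n ι) (w a b : List (IntervalLetter n ι))
    (W M W' : (intervalPresentation C).SquierVertex)
    (h : W.word = a ++ l :: w ++ b) (h' : W'.word = a ++ expandWord C (l :: w) ++ b)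
    (hM : M.word = a ++ l.expand C ++ (w ++ b)) :
    (collapse C (l :: w)).eval a b W W' h h' =
      (collapseLetter C l).eval a (w ++ b) W M (by simp [h]) hM ≫
        (collapse C w).eval (a ++ l.expand C) b M W' (by simp [hM])
          (by simp [h', expandWord]) :=
  Diagram.eval_append (collapseLetter C l) (collapse C w) a b W M W' h h' hM

theorem collapse_singleton_eval (l : IntervalLetter n ι) (a b : List (IntervalLetter n ι))
    (W W' : (intervalPresentation C).SquierVertex)
    (h : W.word = a ++ [l] ++ b) (h' : W'.word = a ++ expandWord C [l] ++ b) :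
    (collapse C [l]).eval a b W W' h h' =
      (collapseLetter C l).eval a b W W' h (by simp [h', expandWord]) := by
  rw [collapse_cons_eval l [] a b W W' W' h h' (by simp [h', expandWord]), collapse_nil_eval,
    Category.comp_id]
  rfl

theorem collapse_append_eval (w w' a b : List (IntervalLetter n ι))
    (W M W' : (intervalPresentation C).SquierVertex)
    (h : W.word = a ++ (w ++ w') ++ b) (h' : W'.word = a ++ expandWord C (w ++ w') ++ b)
    (hM : M.word = a ++ expandWord C w ++ (w' ++ b)) :
    (collapse C (w ++ w')).eval a b W W' h h' =
      (collapse C w).eval a (w' ++ b) W M (by simp [h]) hM ≫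
        (collapse C w').eval (a ++ expandWord C w) b M W' (by simp [hM]) (by simp [h']) := by
  induction w generalizing a W with
  | nil =>
    obtain rfl : W = M := SquierVertex.ext (by simp [h, hM, expandWord])
    rw [collapse_nil_eval, Category.id_comp]
    exact Diagram.eval_congr _ (by simp [expandWord]) rfl _ _ _ _
  | cons l w ih =>
    let N : (intervalPresentation C).SquierVertex :=
      ⟨a ++ l.expand C ++ (w ++ w' ++ b),
        (collapseLetter C l).context_ne_nil (W := W) (by simp [h])⟩
    refine (collapse_cons_eval l (w ++ w') a b W N W' h h' rfl).trans ?_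
    rw [collapse_cons_eval l w a (w' ++ b) W N M (by simp [h]) hM (by simp [N]),
      ih (a ++ l.expand C) N (by simp [N]) (by simpa [expandWord] using h')
        (by simpa [expandWord] using hM), ← Category.assoc]
    rw [Diagram.eval_congr (collapseLetter C l) rfl (List.append_assoc w w' b),
      Diagram.eval_congr (collapse C w') (a' := a ++ expandWord C (l :: w))
        (by simp [expandWord]) rfl]

theorem collapse_map_x_eval (L : List (Fin n)) (a b : List (IntervalLetter n ι))
    (W : (intervalPresentation C).SquierVertex) (h h') :
    (collapse C (L.map .x)).eval a b W W h h' = 𝟙 _ := by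
  induction L generalizing a with
  | nil => exact collapse_nil_eval a b W h h'
  | cons k L ih =>
    refine (collapse_cons_eval (.x k) (L.map .x) a b W W W h h'
      (by simp [h, IntervalLetter.expand])).trans ?_
    rw [ih]
    exact (Category.comp_id _).trans (Diagram.eval_refl _ _ _ _ _ _)

theorem collapse_intervalWord_eval (I : NonemptyInterval (Fin n))
    (a b : List (IntervalLetter n ι))
    (W : (intervalPresentation C).SquierVertex) (h h') :
    (collapse C (intervalWord ι I)).eval a b W W h h' = 𝟙 _ :=
  collapse_map_x_eval _ a b W h h'

/-- An edge `u → v`, followed by the collapse of `v`, is the collapse of `u`, except for the edge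
`c_I → a_I`, where the two differ by a loop around the triangle of `I`. -/
theorem edge_comp_collapse {u v : List (IntervalLetter n ι)}
    (hr : (u, v) ∈ (intervalPresentation C).rels) (a b : List (IntervalLetter n ι))
    (W W' X : (intervalPresentation C).SquierVertex)
    (h : W.word = a ++ u ++ b) (h' : W'.word = a ++ v ++ b)
    (hX : X.word = a ++ expandWord C u ++ b) (hX' : X.word = a ++ expandWord C v ++ b) :
    (Diagram.cell hr).eval a b W W' h h' ≫ (collapse C v).eval a b W' X h' hX' =
        (collapse C u).eval a b W X h hX ∨
      ∃ (i : ι) (hi : X.word = a ++ intervalWord ι (C i) ++ b),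
        (Diagram.cell hr).eval a b W W' h h' ≫ (collapse C v).eval a b W' X h' hX' =
          (collapse C u).eval a b W X h hX ≫ (loopDiagram C i).eval a b X X hi hi := by
  have key : IntervalRelation C (u, v) := hr
  cases key with
  | xa i =>
    left
    obtain rfl : W = X := SquierVertex.ext (by rw [h, hX, expandWord_intervalWord])
    rw [collapse_intervalWord_eval, collapse_singleton_eval]
    exact (congrArg _ (Diagram.eval_symm (cellXA C i) a b _ _ _ _)).trans (IsIso.hom_inv_id _)
  | ab i =>
    left
    have hX : X.word = a ++ intervalWord ι (C i) ++ b := by simpa [expandWord] using! hX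
    rw [collapse_singleton_eval, collapse_singleton_eval]
    change (cellAB C i).eval a b W W' h h' ≫
      ((cellAB C i).symm.trans (cellXA C i).symm).eval a b W' X h' hX =
      (cellXA C i).symm.eval a b W X h hX
    rw [Diagram.eval_trans _ _ a b W' W X h' hX h, Diagram.eval_symm, IsIso.hom_inv_id_assoc]
  | bc i =>
    left
    have hX : X.word = a ++ intervalWord ι (C i) ++ b := by simpa [expandWord] using! hX
    rw [collapse_singleton_eval, collapse_singleton_eval]
    change (cellBC C i).eval a b W W' h h' ≫
      ((cellBC C i).symm.trans ((cellAB C i).symm.trans (cellXA C i).symm)).eval a b W' X h' hX =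
      ((cellAB C i).symm.trans (cellXA C i).symm).eval a b W X h hX
    rw [Diagram.eval_trans _ _ a b W' W X h' hX h, Diagram.eval_symm, IsIso.hom_inv_id_assoc]
  | ca i =>
    right
    have hX : X.word = a ++ intervalWord ι (C i) ++ b := by simpa [expandWord] using! hX
    refine ⟨i, hX, ?_⟩
    let M : (intervalPresentation C).SquierVertex := ⟨a ++ [.b i] ++ b, by simp⟩
    rw [collapse_singleton_eval, collapse_singleton_eval]
    change (cellCA C i).eval a b W W' h h' ≫ (cellXA C i).symm.eval a b W' X h' hX =
      ((cellBC C i).symm.trans ((cellAB C i).symm.trans (cellXA C i).symm)).eval a b W X h hX ≫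
        (loopDiagram C i).eval a b X X hX hX
    rw [loopDiagram, Diagram.eval_trans _ _ a b W M X h hX rfl,
      Diagram.eval_trans _ _ a b M W' X rfl hX h', Diagram.eval_trans _ _ a b X W' X hX hX h',
      Diagram.eval_trans _ _ a b W' M X h' hX rfl, Diagram.eval_trans _ _ a b M W X rfl hX h,
      Diagram.eval_trans _ _ a b W W' X h hX h']
    simp [Diagram.eval_symm]

/-- The path from a vertex `W` to a vertex whose word is the expansion of the word of `W`. -/
noncomputable def collapseArrow (W X : (intervalPresentation C).SquierVertex)
    (h : X.word = expandWord C W.word) :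
    (intervalPresentation C).squierObj W ⟶ (intervalPresentation C).squierObj X :=
  (collapse C W.word).eval [] [] W X (by simp) (by simp [h])

/-- Along a collapse, an edge becomes either trivial or a loop in the expanded word. -/
theorem edgeArrow_comp_collapseArrow {W W' X : (intervalPresentation C).SquierVertex}
    (e : (intervalPresentation C).SquierEdge W W') (h : X.word = expandWord C W.word)
    (h' : X.word = expandWord C W'.word) :
    edgeArrow _ e ≫ collapseArrow W' X h' = collapseArrow W X h ∨
      ∃ (i : ι) (a b : List (IntervalLetter n ι)) (hi : X.word = a ++ intervalWord ι (C i) ++ b),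
        edgeArrow _ e ≫ collapseArrow W' X h' =
          collapseArrow W X h ≫ (loopDiagram C i).eval a b X X hi hi := by
  obtain ⟨w, hw⟩ := W
  obtain ⟨w', hw'⟩ := W'
  obtain ⟨p, u, v, q, hr, h₁, h₂⟩ := e
  obtain rfl : w = p ++ u ++ q := h₁
  obtain rfl : w' = p ++ v ++ q := h₂
  have huv := expandWord_eq_of_mem_rels C hr
  let V := (intervalPresentation C).SquierVertex
  let W : V := ⟨p ++ u ++ q, hw⟩
  let W' : V := ⟨p ++ v ++ q, hw'⟩
  have hu := (intervalPresentation C).fst_ne_nil _ hr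
  have hv := (intervalPresentation C).snd_ne_nil _ hr
  have hu' : expandWord C u ≠ [] := fun h0 => hu ((collapse C u).eq_nil_iff.2 h0)
  -- `M`, `M'` are reached from `W`, `W'` by collapsing `p`, and `N` by then collapsing `u` or `v`.
  let M : V := ⟨expandWord C p ++ u ++ q, by simp [hu]⟩
  let M' : V := ⟨expandWord C p ++ v ++ q, by simp [hv]⟩
  let N : V := ⟨expandWord C p ++ expandWord C u ++ q, by simp [hu']⟩
  have expand : ∀ (s : List (IntervalLetter n ι)) (Y Z : V) (hY : Y.word = p ++ s ++ q)
      (hZ : Z.word = expandWord C p ++ s ++ q) (hN : N.word = expandWord C p ++ expandWord C s ++ q)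
      (hX : X.word = expandWord C (p ++ s ++ q)) (hXu : X.word = expandWord C (p ++ u ++ q)),
      (collapse C (p ++ s ++ q)).eval [] [] Y X (by simp [hY]) (by simp [hX]) =
        (collapse C p).eval [] (s ++ q) Y Z (by simp [hY]) (by simp [hZ]) ≫
        (collapse C s).eval (expandWord C p) q Z N hZ hN ≫
        (collapse C q).eval (expandWord C p ++ expandWord C u) [] N X (by simp [N])
          (by simp [hXu]) := by
    intro s Y Z hY hZ hN hX hXu
    have hsu : expandWord C s = expandWord C u :=
      List.append_cancel_left (List.append_cancel_right (hN.symm.trans rfl))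
    rw [collapse_append_eval (p ++ s) q [] [] Y N X (by simp [hY]) (by simp [hX]) (by simp [hN]),
      collapse_append_eval p s [] (q ++ []) Y Z N (by simp [hY]) (by simp [hN]) (by simp [hZ]),
      Category.assoc]
    rw [Diagram.eval_congr (collapse C p) rfl (show s ++ (q ++ []) = s ++ q by simp),
      Diagram.eval_congr (collapse C s) (List.nil_append _) (List.append_nil q),
      Diagram.eval_congr (collapse C q) (a' := expandWord C p ++ expandWord C u)
        (by simp [hsu]) rfl]
  have E := expand u W M rfl rfl rfl h h
  have E' := expand v W' M' rfl rfl (by rw [← huv]) h' h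
  -- Collapsing `p` does not interact with the edge.
  have slide := Diagram.eval_comm (collapse C p) (Diagram.cell hr) [] [] q (u ++ q) (v ++ q) p
    (expandWord C p) W M W' M' (by simp) (by simp) (by simp) (by simp)
    (by simp [W]) (by simp [M]) (by simp [W']) (by simp [M']) rfl rfl rfl rfl
  change (Diagram.cell hr).eval p q W W' rfl rfl ≫ (collapse C (p ++ v ++ q)).eval [] [] W' X _ _ =
      (collapse C (p ++ u ++ q)).eval [] [] W X _ _ ∨ ∃ i a b hi,
    (Diagram.cell hr).eval p q W W' rfl rfl ≫ (collapse C (p ++ v ++ q)).eval [] [] W' X _ _ =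
      (collapse C (p ++ u ++ q)).eval [] [] W X _ _ ≫ (loopDiagram C i).eval a b X X hi hi
  rw [E, E', ← Category.assoc ((Diagram.cell hr).eval p q W W' rfl rfl), ← slide]
  rcases edge_comp_collapse hr (expandWord C p) q M M' N rfl rfl rfl (by rw [← huv]) with
    hl | ⟨i, hi, hl⟩
  · left
    rw [Category.assoc, reassoc_of% hl]
  · right
    have hi' : intervalWord ι (C i) = expandWord C u :=
      List.append_cancel_left (List.append_cancel_right (hi.symm.trans rfl))
    refine ⟨i, expandWord C p, expandWord C q, by simpa [hi'] using h, ?_⟩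
    rw [Category.assoc, reassoc_of% hl]
    simp only [Category.assoc]
    congr 2
    -- The loop is slid past the collapse of `q`, to the end of the path.
    exact Diagram.eval_comm (loopDiagram C i) (collapse C q) (expandWord C p) [] [] q
      (expandWord C q) (expandWord C p ++ expandWord C u) (expandWord C p ++ expandWord C u)
      N N X X (by simp) (by simp) (by simp [hi']) (by simp [hi']) _ _ _ _ _ _ _ _

end Collapse

/-! ### The isomorphism -/

section Isomorphism

variable {n : ℕ} (hn : 0 < n) {ι : Type u} (C : ι → NonemptyInterval (Fin n))

/-- The loop at the base word that travels once around the triangle of `i`. -/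
noncomputable def generatorLoop (i : ι) :
    (intervalPresentation C).DiagramGroup (intervalBaseWord hn C) :=
  (loopDiagram C i).eval (leftWord ι (C i)) (rightWord ι (C i)) (intervalBaseWord hn C)
    (intervalBaseWord hn C) (map_x_eq (C i)) (map_x_eq (C i))

variable {C} in
theorem loopDiagram_eval_eq_generatorLoop (i : ι) (a b : List (IntervalLetter n ι)) (h h') :
    (loopDiagram C i).eval a b (intervalBaseWord hn C) (intervalBaseWord hn C) h h' =
      generatorLoop hn C i :=
  have e := eq_leftWord_and_eq_rightWord h.symm
  Diagram.eval_congr _ e.1 e.2 _ _ _ _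

variable {C} in
theorem generatorLoop_commute_of_lt {i j : ι} (h : (C i).snd < (C j).fst) :
    Commute (generatorLoop hn C i) (generatorLoop hn C j) := by
  obtain ⟨b, c, e⟩ := exists_map_x_eq (ι := ι) h
  have := Diagram.eval_comm (loopDiagram C i) (loopDiagram C j) (leftWord ι (C i)) b c _ _ _ _
    (intervalBaseWord hn C) (intervalBaseWord hn C) (intervalBaseWord hn C)
    (intervalBaseWord hn C) rfl rfl rfl rfl (e.trans (by simp)) (e.trans (by simp))
    (e.trans (by simp)) (e.trans (by simp)) e e e e
  have hi := loopDiagram_eval_eq_generatorLoop (C := C) hn i (leftWord ι (C i))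
    (b ++ intervalWord ι (C j) ++ c) (e.trans (by simp)) (e.trans (by simp))
  have hj := loopDiagram_eval_eq_generatorLoop (C := C) hn j
    (leftWord ι (C i) ++ intervalWord ι (C i) ++ b) c e e
  exact (congrArg₂ (· ≫ ·) hi hj).symm.trans (this.trans (congrArg₂ (· ≫ ·) hj hi))

/-- The homomorphism sending the generator of `i` to the loop around the triangle of `i`. -/
noncomputable def loopHom :
    IntervalArtinGroup C →* (intervalPresentation C).DiagramGroup (intervalBaseWord hn C) :=
  PresentedGroup.toGroup (f := generatorLoop hn C) <| by
    rintro _ ⟨i, j, hij, rfl⟩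
    rw [SimpleGraph.compl_adj] at hij
    have hd : ∀ k, ¬ (k ∈ C i ∧ k ∈ C j) := fun k hk => hij.2 ⟨hij.1, k, hk⟩
    have hc : Commute (generatorLoop hn C i) (generatorLoop hn C j) := by
      rcases lt_or_ge (C i).snd (C j).fst with h | h
      · exact generatorLoop_commute_of_lt hn h
      rcases lt_or_ge (C j).snd (C i).fst with h' | h'
      · exact (generatorLoop_commute_of_lt hn h').symm
      -- Two intervals, neither of which lies to the left of the other, share the larger of their
      -- left end points.
      exact (hd (max (C i).fst (C j).fst) ⟨⟨le_max_left _ _, max_le (C i).fst_le_snd h⟩,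
        ⟨le_max_right _ _, max_le h' (C j).fst_le_snd⟩⟩).elim
    simp only [map_mul, map_inv, FreeGroup.lift_apply_of]
    rw [hc.eq, mul_inv_cancel_right, mul_inv_cancel]

theorem loopHom_of (i : ι) : loopHom hn C (.of i) = generatorLoop hn C i :=
  PresentedGroup.toGroup.of _

variable {C}

theorem covers_baseWord : Covers C (intervalBaseWord hn C).word :=
  expandWord_map_x C _

theorem labelFunctor_map_cell {u v : List (IntervalLetter n ι)}
    (hr : (u, v) ∈ (intervalPresentation C).rels) (a b : List (IntervalLetter n ι))
    (W W' : (intervalPresentation C).SquierVertex) (h h') (hW : Covers C W.word) :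
    (labelFunctor C).map ((Diagram.cell hr).eval a b W W' h h') = op (edgeLabel C u) :=
  labelFunctor_map_edgeArrow C hW _

theorem labelHom_generatorLoop (i : ι) :
    labelHom C _ (generatorLoop hn C i) = .of i := by
  let a := leftWord ι (C i)
  let b := rightWord ι (C i)
  let V := (intervalPresentation C).SquierVertex
  let B : V := intervalBaseWord hn C
  let W₁ : V := ⟨a ++ [.a i] ++ b, by simp⟩
  let W₂ : V := ⟨a ++ [.b i] ++ b, by simp⟩
  let W₃ : V := ⟨a ++ [.c i] ++ b, by simp⟩
  have h₀ : B.word = a ++ intervalWord ι (C i) ++ b := map_x_eq (C i)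
  have c₀ : Covers C B.word := covers_baseWord hn
  have c₁ : Covers C W₁.word := (covers_congr (.xa i)).1 (h₀ ▸ c₀)
  have c₂ : Covers C W₂.word := (covers_congr (.ab i)).1 c₁
  have c₃ : Covers C W₃.word := (covers_congr (.bc i)).1 c₂
  have e : generatorLoop hn C i =
      (cellXA C i).eval a b B W₁ h₀ rfl ≫ (cellAB C i).eval a b W₁ W₂ rfl rfl ≫
        (cellBC C i).eval a b W₂ W₃ rfl rfl ≫ (cellCA C i).eval a b W₃ W₁ rfl rfl ≫
        inv ((cellXA C i).eval a b B W₁ h₀ rfl) := by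
    change (loopDiagram C i).eval a b B B h₀ h₀ = _
    rw [loopDiagram, Diagram.eval_trans _ _ a b B W₁ B h₀ h₀ rfl,
      Diagram.eval_trans _ _ a b W₁ W₂ B rfl h₀ rfl, Diagram.eval_trans _ _ a b W₂ W₃ B rfl h₀ rfl,
      Diagram.eval_trans _ _ a b W₃ W₁ B rfl h₀ rfl, Diagram.eval_symm]
  change unop ((labelFunctor C).map (generatorLoop hn C i)) = _
  rw [e]
  simp only [Functor.map_comp, Functor.map_inv, SingleObj.comp_as_mul, SingleObj.inv_as_inv]
  have l₁ : (labelFunctor C).map ((cellXA C i).eval a b B W₁ h₀ rfl) = op 1 :=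
    (labelFunctor_map_cell _ _ _ _ _ _ _ c₀).trans (congrArg op (edgeLabel_intervalWord C (C i)))
  have l₂ : (labelFunctor C).map ((cellAB C i).eval a b W₁ W₂ rfl rfl) = op 1 :=
    labelFunctor_map_cell _ _ _ _ _ _ _ c₁
  have l₃ : (labelFunctor C).map ((cellBC C i).eval a b W₂ W₃ rfl rfl) = op 1 :=
    labelFunctor_map_cell _ _ _ _ _ _ _ c₂
  have l₄ : (labelFunctor C).map ((cellCA C i).eval a b W₃ W₁ rfl rfl) = op (.of i) :=
    labelFunctor_map_cell _ _ _ _ _ _ _ c₃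
  rw [l₁, l₂, l₃, l₄]
  change unop ((op 1)⁻¹ * op (.of i) * op 1 * op 1 * op 1 : (IntervalArtinGroup C)ᵐᵒᵖ) = _
  simp

theorem labelHom_loopHom (g : IntervalArtinGroup C) : labelHom C _ (loopHom hn C g) = g := by
  have : (labelHom C _).comp (loopHom hn C) = MonoidHom.id _ :=
    PresentedGroup.ext fun i => by
      rw [MonoidHom.comp_apply, loopHom_of, labelHom_generatorLoop, MonoidHom.id_apply]
  exact DFunLike.congr_fun this g

/-- The path from a covering word to the base word that collapses its letters. -/
noncomputable def collapseToBase (W : (intervalPresentation C).SquierVertex)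
    (h : Covers C W.word) :
    (intervalPresentation C).squierObj W ⟶
      (intervalPresentation C).squierObj (intervalBaseWord hn C) :=
  collapseArrow W (intervalBaseWord hn C) h.symm

theorem collapseToBase_baseWord (h) : collapseToBase hn (intervalBaseWord hn C) h = 𝟙 _ :=
  collapse_map_x_eval _ _ _ _ _ _

variable (C) in
/-- The value of `loopHom`, as an arrow of the fundamental groupoid. -/
noncomputable def loopArrow (g : IntervalArtinGroup C) :
    (intervalPresentation C).squierObj (intervalBaseWord hn C) ⟶
      (intervalPresentation C).squierObj (intervalBaseWord hn C) :=
  loopHom hn C g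

theorem loopArrow_one : loopArrow hn C 1 = 𝟙 _ := map_one (loopHom hn C)

theorem loopArrow_mul (g g' : IntervalArtinGroup C) :
    loopArrow hn C (g * g') = loopArrow hn C g ≫ loopArrow hn C g' := map_mul (loopHom hn C) g g'

theorem exists_edgeArrow_comp_collapseToBase_eq {W W' : (intervalPresentation C).SquierVertex}
    (e : (intervalPresentation C).SquierEdge W W') (h : Covers C W.word)
    (h' : Covers C W'.word) : ∃ g : IntervalArtinGroup C,
      edgeArrow _ e ≫ collapseToBase hn W' h' = collapseToBase hn W h ≫ loopArrow hn C g := by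
  rcases edgeArrow_comp_collapseArrow (X := intervalBaseWord hn C) e h.symm h'.symm with
    he | ⟨i, a, b, hi, he⟩
  · refine ⟨1, ?_⟩
    rw [loopArrow_one, Category.comp_id]
    exact he
  · refine ⟨.of i, he.trans (congrArg _ ?_)⟩
    exact (loopDiagram_eval_eq_generatorLoop hn i a b hi hi).trans (loopHom_of hn C i).symm

/-- Up to the collapsing paths, every edge path between covering words is a product of loops. -/
theorem exists_comp_collapseToBase_eq (W W' : (intervalPresentation C).SquierVertex)
    (f : (intervalPresentation C).squierObj W ⟶ (intervalPresentation C).squierObj W')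
    (h : Covers C W.word) (h' : Covers C W'.word) : ∃ g : IntervalArtinGroup C,
      f ≫ collapseToBase hn W' h' = collapseToBase hn W h ≫ loopArrow hn C g := by
  revert h h'
  refine squier_induction (motive := fun W W' f => ∀ (h : Covers C W.word)
    (h' : Covers C W'.word), ∃ g : IntervalArtinGroup C,
      f ≫ collapseToBase hn W' h' = collapseToBase hn W h ≫ loopArrow hn C g) ?_ ?_ ?_ W W' f
  · intro W h _
    exact ⟨1, by rw [loopArrow_one, Category.comp_id, Category.id_comp]⟩
  · intro W W' W'' f e ih h h''
    have h' := (covers_iff_of_edge e).2 h''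
    obtain ⟨g, hg⟩ := ih h h'
    obtain ⟨g', hg'⟩ := exists_edgeArrow_comp_collapseToBase_eq hn e h' h''
    exact ⟨g * g', by rw [Category.assoc, hg', reassoc_of% hg, loopArrow_mul]⟩
  · intro W W' W'' f e ih h h''
    have h' := (covers_iff_of_edge e).1 h''
    obtain ⟨g, hg⟩ := ih h h'
    obtain ⟨g', hg'⟩ := exists_edgeArrow_comp_collapseToBase_eq hn e h'' h'
    have key : inv (edgeArrow _ e) ≫ collapseToBase hn W'' h'' =
        collapseToBase hn W' h' ≫ loopArrow hn C g'⁻¹ := by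
      rw [IsIso.inv_comp_eq, reassoc_of% hg', ← loopArrow_mul, mul_inv_cancel, loopArrow_one,
        Category.comp_id]
    exact ⟨g * g'⁻¹, by rw [Category.assoc, key, reassoc_of% hg, loopArrow_mul]⟩

theorem loopHom_surjective : Function.Surjective (loopHom hn C) := by
  intro f
  change (intervalPresentation C).squierObj (intervalBaseWord hn C) ⟶
    (intervalPresentation C).squierObj (intervalBaseWord hn C) at f
  obtain ⟨g, hg⟩ := exists_comp_collapseToBase_eq hn (intervalBaseWord hn C)
    (intervalBaseWord hn C) f (covers_baseWord hn) (covers_baseWord hn)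
  rw [collapseToBase_baseWord, Category.comp_id, Category.id_comp] at hg
  exact ⟨g, hg.symm⟩

variable (C) in
/-- The diagram group of `P(C)` is the right-angled Artin group on the complement of the
intersection graph of `C`. -/
noncomputable def diagramGroupEquiv :
    (intervalPresentation C).DiagramGroup (intervalBaseWord hn C) ≃* IntervalArtinGroup C :=
  (MulEquiv.ofBijective (loopHom hn C)
    ⟨Function.LeftInverse.injective (labelHom_loopHom hn), loopHom_surjective hn⟩).symm

end Isomorphism

/-! ### Discretising interval graphs -/

/-- A finite family of real intervals can be replaced by a family of discrete intervals, with the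
same intersection graph: restrict to a finite set of points that contains a point of every nonempty
pairwise intersection. -/
theorem IsIntervalGraph.exists_eq_intersectionGraph {V : Type u} [Finite V] {Γ : SimpleGraph V}
    (hΓ : IsIntervalGraph Γ) :
    ∃ n : ℕ, 0 < n ∧ ∃ C : V → NonemptyInterval (Fin n),
      Γ = intersectionGraph fun x => (C x : Set (Fin n)) := by
  classical
  cases nonempty_fintype V
  obtain ⟨S, hS, rfl⟩ := hΓ
  let p : V × V → ℝ := fun x => if h : (S x.1 ∩ S x.2).Nonempty then h.some else 0
  have hp : ∀ x y, (S x ∩ S y).Nonempty → p (x, y) ∈ S x ∩ S y := fun x y h => by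
    simpa only [p, dif_pos h] using h.some_mem
  -- The point `0` only serves to make the set nonempty when `V` is empty.
  let F : Finset ℝ := insert 0 (Finset.univ.image p)
  let e : Fin F.card ≃o F := F.orderIsoOfFin rfl
  have hF : ∀ x y, (S x ∩ S y).Nonempty → ∃ k, (e k : ℝ) ∈ S x ∧ (e k : ℝ) ∈ S y := by
    intro x y h
    refine ⟨e.symm ⟨p (x, y), by simp [F]⟩, ?_⟩
    simpa using hp x y h
  let T : V → Finset (Fin F.card) := fun x => Finset.univ.filter fun k => (e k : ℝ) ∈ S x
  have hT : ∀ x, (T x).Nonempty := fun x => by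
    obtain ⟨k, hk, -⟩ := hF x x (by simpa using (hS x).2)
    exact ⟨k, by simpa [T] using hk⟩
  refine ⟨F.card, Finset.card_pos.2 ⟨0, by simp [F]⟩,
    fun x => ⟨⟨(T x).min' (hT x), (T x).max' (hT x)⟩, (T x).min'_le_max' (hT x)⟩, ?_⟩
  have hmem : ∀ x k, ((T x).min' (hT x) ≤ k ∧ k ≤ (T x).max' (hT x)) ↔ (e k : ℝ) ∈ S x := by
    intro x k
    constructor
    · rintro ⟨h₁, h₂⟩
      have h₃ := (Finset.mem_filter.1 ((T x).min'_mem (hT x))).2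
      have h₄ := (Finset.mem_filter.1 ((T x).max'_mem (hT x))).2
      exact (hS x).1.out h₃ h₄ ⟨e.monotone h₁, e.monotone h₂⟩
    · intro h
      have h' : k ∈ T x := by simpa [T] using h
      exact ⟨(T x).min'_le _ h', (T x).le_max' _ h'⟩
  ext x y
  refine and_congr_right fun _ => ⟨fun h => ?_, ?_⟩
  · obtain ⟨k, hx, hy⟩ := hF x y h
    exact ⟨k, (hmem x k).2 hx, (hmem y k).2 hy⟩
  · rintro ⟨k, hx, hy⟩
    exact ⟨e k, (hmem x k).1 hx, (hmem y k).1 hy⟩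

theorem theorem1p8 :
    (∀ (n : ℕ) (hn : 0 < n) (ι : Type u) [Finite ι] (C : ι → NonemptyInterval (Fin n)),
      Nonempty ((intervalPresentation C).DiagramGroup (intervalBaseWord hn C) ≃*
        RightAngledArtinGroup (intersectionGraph fun i => (C i : Set (Fin n)))ᶜ)) ∧
    (∀ (V : Type u) [Finite V] (Γ : SimpleGraph V), IsIntervalGraph Γ →
      (∃ n : ℕ, 0 < n ∧ ∃ C : V → NonemptyInterval (Fin n),
        Γ = intersectionGraph fun x => (C x : Set (Fin n))) ∧
      IsDiagramGroup (RightAngledArtinGroup Γᶜ)) := by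
  refine ⟨fun n hn ι _ C => ⟨diagramGroupEquiv hn C⟩, fun V _ Γ hΓ => ?_⟩
  obtain ⟨n, hn, C, rfl⟩ := hΓ.exists_eq_intersectionGraph
  exact ⟨⟨n, hn, C, rfl⟩, _, intervalPresentation C, intervalBaseWord hn C,
    ⟨(diagramGroupEquiv hn C).symm⟩⟩
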